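/- **Theorem (Stability theorem, associative version).** Let $k$ be a field and let $(X,d_X)$, $(Y,d_Y)$ be metric spaces. *Conventions.* For $a\in\mathbb R$ let $\mathcal R_a(X)$ (resp. $\check{\mathcal C}_a(X)$) be the simplicial set whose $n$-simplices are the tuples $[x_0,\dots,x_n]$ of points of $X$ (repetitions allowed) with $d_X(x_i,x_j)\le a$ for all $i,j$ (resp. such that the closed balls $\mathrm B(x_i,a)$, $0\le i\le n$, have a common point in $X$). With the inclusions for $a\le b$ these give the Vietoris–Rips and the intrinsic Čech filtrations $\mathcal R(X),\check{\mathcal C}(X):(\mathbb R,\le)\to\mathsf{sSet}$. For a simplicial set $S$, $\mathrm C^*(S)=\mathrm{Hom}_k(k[S],k)$ is the unital differential graded (dg) algebra of $k$-valued cochains with the cup product, and $\mathrm H^*(S)$ is its cohomology algebra; for a topological space $T$, $\mathrm C^*(T)=\mathrm C^*(\mathrm{Sing}\,T)$ and $\mathrm H^*(T)$ is its cohomology. Let $\mathsf{Alg}_{As}$ be the category of $\mathbb Z$-graded unital dg-algebras over $k$ with strict morphisms (a graded algebra is a dg-algebra with zero differential), and $\mathsf{ho}(\mathsf{Alg}_{As})$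 its localization at the quasi-isomorphisms. Two functors $F,G:(\mathbb R,\le)^{\mathrm{op}}\to\mathsf C$ are $\varepsilon$-interleaved ($\varepsilon\ge 0$) if there are natural transformations $\mu:F^{r}\to G^{r-\varepsilon}$ and $\nu:G^{r}\to F^{r-\varepsilon}$ ($r\in\mathbb R$) whose two composites are the structural morphisms $F^r\to F^{r-2\varepsilon}$ and $G^r\to G^{r-2\varepsilon}$; and $d_{\mathsf C}(F,G)\in[0,\infty]$ is the infimum of the $\varepsilon\ge0$ for which $F$ and $G$ are $\varepsilon$-interleaved. Finally $$d_{GH}(X,Y)=\tfrac12\inf_{C}\ \sup_{(x,y),(x',y')\in C}|d_X(x,x')-d_Y(y,y')|\in[0,\infty],$$ the infimum being over all correspondences $C\subseteq X\times Y$, i.e. subsets projecting onto $X$ and onto $Y$. *Statement.* 1. In the homotopy category $\mathsf{ho}(\mathsf{Alg}_{As})$: $$d_{\mathsf{ho}(\mathsf{Alg}_{As})}\big(\mathrm C^*(\mathcal R(X)),\mathrm C^*(\mathcal R(Y))\big)\le 2\,d_{GH}(X,Y),\qquad d_{\mathsf{ho}(\mathsf{Alg}_{As})}\big(\mathrm C^*(\check{\mathcal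 C}(X)),\mathrm C^*(\check{\mathcal C}(Y))\big)\le 2\,d_{GH}(X,Y).$$ 2. In the strict category $\mathsf{Alg}_{As}$, for the cohomology algebras with the cup product: $$d_{\mathsf{Alg}_{As}}\big(\mathrm H^*(\mathcal R(X)),\mathrm H^*(\mathcal R(Y))\big)\le 2\,d_{GH}(X,Y),\qquad d_{\mathsf{Alg}_{As}}\big(\mathrm H^*(\check{\mathcal C}(X)),\mathrm H^*(\check{\mathcal C}(Y))\big)\le 2\,d_{GH}(X,Y).$$ Both parts also hold when the filtered simplicial sets $\mathcal R(-)$ and $\check{\mathcal C}(-)$ are replaced by the filtered topological spaces obtained from them by geometric realization, with singular cochains and singular cohomology. -/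

import Mathlib

open CategoryTheory Opposite
open scoped ENNReal NNReal

universe u v w

/-! ### Differential graded associative algebras -/

/-- A (unital) differential graded associative algebra over a field `k`: a `ℤ`-graded cochain
complex of `k`-vector spaces with an associative unital product of degree `0` satisfying the
graded Leibniz rule. The differential `A^m → A^n` is available whenever `m + 1 = n` and the
product `A^p ⊗ A^q → A^n` whenever `p + q = n`. -/
structure DGAlg (k : Type w) [Field k] where
  carrier : ℤ → Type v
  [addCommGroup : ∀ n, AddCommGroup (carrier n)]
  [module : ∀ n, Module k (carrier n)]
  d : ∀ m n : ℤ, m + 1 = n → (carrier m →ₗ[k] carrier n)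
  mul : ∀ p q n : ℤ, p + q = n → (carrier p →ₗ[k] carrier q →ₗ[k] carrier n)
  one : carrier 0
  d_d : ∀ (l m n : ℤ) (h : l + 1 = m) (h' : m + 1 = n) (x : carrier l),
    d m n h' (d l m h x) = 0
  mul_assoc : ∀ (p q r pq qr n : ℤ) (hpq : p + q = pq) (hqr : q + r = qr) (h : pq + r = n)
    (h' : p + qr = n) (x : carrier p) (y : carrier q) (z : carrier r),
    mul pq r n h (mul p q pq hpq x y) z = mul p qr n h' x (mul q r qr hqr y z)
  one_mul : ∀ (n : ℤ) (h : 0 + n = n) (x : carrier n), mul 0 n n h one x = x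
  mul_one : ∀ (n : ℤ) (h : n + 0 = n) (x : carrier n), mul n 0 n h x one = x
  leibniz : ∀ (p q n p' q' n' : ℤ) (h : p + q = n) (hp : p + 1 = p') (hq : q + 1 = q')
    (hn : n + 1 = n') (h₁ : p' + q = n') (h₂ : p + q' = n') (x : carrier p) (y : carrier q),
    d n n' hn (mul p q n h x y) =
      mul p' q n' h₁ (d p p' hp x) y + p.negOnePow • mul p q' n' h₂ x (d q q' hq y)

namespace DGAlg

attribute [instance] DGAlg.addCommGroup DGAlg.module

variable {k : Type w} [Field k]

/-- Strict morphisms of dg-algebras. -/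
@[ext]
structure Hom (A B : DGAlg.{v} k) where
  toFun : ∀ n : ℤ, A.carrier n →ₗ[k] B.carrier n
  map_d : ∀ (m n : ℤ) (h : m + 1 = n) (x : A.carrier m),
    toFun n (A.d m n h x) = B.d m n h (toFun m x)
  map_mul : ∀ (p q n : ℤ) (h : p + q = n) (x : A.carrier p) (y : A.carrier q),
    toFun n (A.mul p q n h x y) = B.mul p q n h (toFun p x) (toFun q y)
  map_one : toFun 0 A.one = B.one

/-- The category of dg-algebras over `k`, with strict morphisms. -/
instance : Category (DGAlg.{v} k) where
  Hom A B := Hom A B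
  id A :=
    { toFun := fun _ => LinearMap.id
      map_d := fun _ _ _ _ => rfl
      map_mul := fun _ _ _ _ _ _ => rfl
      map_one := rfl }
  comp f g :=
    { toFun := fun n => g.toFun n ∘ₗ f.toFun n
      map_d := fun m n h x => by simp [f.map_d, g.map_d]
      map_mul := fun p q n h x y => by simp [f.map_mul, g.map_mul]
      map_one := by simp [f.map_one, g.map_one] }

@[ext]
theorem hom_ext {A B : DGAlg.{v} k} {f g : A ⟶ B} (h : ∀ n, f.toFun n = g.toFun n) : f = g :=
  Hom.ext (funext h)

@[simp]
theorem id_toFun (A : DGAlg.{v} k) (n : ℤ) (x : A.carrier n) : Hom.toFun (𝟙 A) n x = x := rfl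

@[simp]
theorem comp_toFun {A B C : DGAlg.{v} k} (f : A ⟶ B) (g : B ⟶ C) (n : ℤ) (x : A.carrier n) :
    (f ≫ g).toFun n x = g.toFun n (f.toFun n x) := rfl

theorem d_one (A : DGAlg.{v} k) (n : ℤ) (h : 0 + 1 = n) : A.d 0 n h A.one = 0 := by
  have := A.leibniz 0 0 0 n n n (by omega) h h h (by omega) (by omega) A.one A.one
  rw [A.one_mul, A.mul_one, A.one_mul] at this
  simpa using this

/-! ### Cohomology -/

/-- Degree `n` cocycles. -/
def cocycles (A : DGAlg.{v} k) (n : ℤ) : Submodule k (A.carrier n) :=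
  LinearMap.ker (A.d n (n + 1) rfl)

/-- Degree `n` coboundaries. -/
def coboundaries (A : DGAlg.{v} k) (n : ℤ) : Submodule k (A.carrier n) :=
  LinearMap.range (A.d (n - 1) n (sub_add_cancel n 1))

theorem mem_cocycles {A : DGAlg.{v} k} {m : ℤ} (n : ℤ) (h : m + 1 = n) {x : A.carrier m} :
    x ∈ A.cocycles m ↔ A.d m n h x = 0 := by
  subst h; rfl

theorem mem_coboundaries {A : DGAlg.{v} k} (m : ℤ) {n : ℤ} (h : m + 1 = n) {x : A.carrier n} :
    x ∈ A.coboundaries n ↔ ∃ y, A.d m n h y = x := by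
  obtain rfl : m = n - 1 := by omega
  rfl

/-- `H^n(A)`: cocycles modulo coboundaries. -/
abbrev cohomology (A : DGAlg.{v} k) (n : ℤ) : Type v :=
  A.cocycles n ⧸ (A.coboundaries n).submoduleOf (A.cocycles n)

theorem mul_mem_cocycles (A : DGAlg.{v} k) {p q n : ℤ} (h : p + q = n) {x : A.carrier p}
    {y : A.carrier q} (hx : x ∈ A.cocycles p) (hy : y ∈ A.cocycles q) :
    A.mul p q n h x y ∈ A.cocycles n := by
  rw [mem_cocycles _ rfl] at *
  rw [A.leibniz p q n (p + 1) (q + 1) (n + 1) h rfl rfl rfl (by omega) (by omega), hx, hy]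
  simp

/-- The product of cocycles, with values in cohomology. -/
def cocyclesMul (A : DGAlg.{v} k) (p q n : ℤ) (h : p + q = n) :
    A.cocycles p →ₗ[k] A.cocycles q →ₗ[k] A.cohomology n :=
  LinearMap.mk₂ k
    (fun x y => Submodule.Quotient.mk ⟨A.mul p q n h x y, A.mul_mem_cocycles h x.2 y.2⟩)
    (fun x x' y => by rw [← Submodule.Quotient.mk_add]; congr 1; ext; simp)
    (fun c x y => by rw [← Submodule.Quotient.mk_smul]; congr 1; ext; simp)
    (fun x y y' => by rw [← Submodule.Quotient.mk_add]; congr 1; ext; simp)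
    (fun c x y => by rw [← Submodule.Quotient.mk_smul]; congr 1; ext; simp)

theorem cocyclesMul_eq_zero_left (A : DGAlg.{v} k) (p q n : ℤ) (h : p + q = n) :
    (A.coboundaries p).submoduleOf (A.cocycles p) ≤ LinearMap.ker (A.cocyclesMul p q n h) := by
  rintro ⟨x, hx⟩ hx'
  obtain ⟨z, rfl⟩ := (mem_coboundaries (p - 1) (by omega)).1 hx'
  refine LinearMap.mem_ker.2 (LinearMap.ext fun y => ?_)
  refine (Submodule.Quotient.mk_eq_zero _).2 ?_
  refine (mem_coboundaries (n - 1) (by omega)).2 ⟨A.mul (p - 1) q (n - 1) (by omega) z y, ?_⟩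
  rw [A.leibniz (p - 1) q (n - 1) p (q + 1) n (by omega) (by omega) rfl (by omega) h (by omega),
    (mem_cocycles (q + 1) rfl).1 y.2]
  simp

theorem cocyclesMul_eq_zero_right (A : DGAlg.{v} k) (p q n : ℤ) (h : p + q = n) :
    (A.coboundaries q).submoduleOf (A.cocycles q) ≤
      LinearMap.ker (A.cocyclesMul p q n h).flip := by
  rintro ⟨y, hy⟩ hy'
  obtain ⟨z, rfl⟩ := (mem_coboundaries (q - 1) (by omega)).1 hy'
  refine LinearMap.mem_ker.2 (LinearMap.ext fun x => ?_)
  refine (Submodule.Quotient.mk_eq_zero _).2 ?_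
  refine (mem_coboundaries (n - 1) (by omega)).2
    ⟨p.negOnePow • A.mul p (q - 1) (n - 1) (by omega) x z, ?_⟩
  have := A.leibniz p (q - 1) (n - 1) (p + 1) q n (by omega) rfl (by omega) (by omega)
    (by omega) h x z
  rw [(mem_cocycles (p + 1) rfl).1 x.2] at this
  simp only [map_zero, LinearMap.zero_apply, zero_add] at this
  rw [Units.smul_def, map_zsmul, this, ← Units.smul_def, smul_smul, ← Int.negOnePow_add,
    Int.negOnePow_even _ ⟨p, rfl⟩, one_smul]
  rfl

/-- The product induced on cohomology. -/
def cohomologyMul (A : DGAlg.{v} k) (p q n : ℤ) (h : p + q = n) :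
    A.cohomology p →ₗ[k] A.cohomology q →ₗ[k] A.cohomology n :=
  (A.cocyclesMul p q n h).liftQ₂ _ _ (A.cocyclesMul_eq_zero_left p q n h)
    (A.cocyclesMul_eq_zero_right p q n h)

theorem cohomologyMul_mk (A : DGAlg.{v} k) (p q n : ℤ) (h : p + q = n) (x : A.cocycles p)
    (y : A.cocycles q) :
    A.cohomologyMul p q n h (Submodule.Quotient.mk x) (Submodule.Quotient.mk y) =
      Submodule.Quotient.mk ⟨A.mul p q n h x y, A.mul_mem_cocycles h x.2 y.2⟩ := rfl

/-- The cohomology algebra `H^*(A)`, a dg-algebra with zero differential. -/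
def cohomologyAlg (A : DGAlg.{v} k) : DGAlg.{v} k where
  carrier := A.cohomology
  d _ _ _ := 0
  mul := A.cohomologyMul
  one := Submodule.Quotient.mk ⟨A.one, A.d_one _ _⟩
  d_d _ _ _ _ _ _ := rfl
  mul_assoc p q r pq qr n hpq hqr h h' x y z := by
    induction x using Submodule.Quotient.induction_on
    induction y using Submodule.Quotient.induction_on
    induction z using Submodule.Quotient.induction_on
    simp only [cohomologyMul_mk, A.mul_assoc p q r pq qr n hpq hqr h h']
  one_mul n h x := by
    induction x using Submodule.Quotient.induction_on
    simp only [cohomologyMul_mk, A.one_mul]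
  mul_one n h x := by
    induction x using Submodule.Quotient.induction_on
    simp only [cohomologyMul_mk, A.mul_one]
  leibniz _ _ _ _ _ _ _ _ _ _ _ _ _ _ := by simp

/-- The map induced on cocycles by a morphism of dg-algebras. -/
def cocyclesMap {A B : DGAlg.{v} k} (f : A ⟶ B) (n : ℤ) : A.cocycles n →ₗ[k] B.cocycles n :=
  (f.toFun n).restrict fun x hx => by
    rw [mem_cocycles _ rfl] at *
    rw [← f.map_d, hx, map_zero]

/-- The map induced on cohomology by a morphism of dg-algebras. -/
def cohomologyMap {A B : DGAlg.{v} k} (f : A ⟶ B) (n : ℤ) :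
    A.cohomology n →ₗ[k] B.cohomology n :=
  Submodule.mapQ _ _ (cocyclesMap f n) (by
    rintro ⟨x, hx⟩ hx'
    obtain ⟨y, rfl⟩ := (mem_coboundaries (n - 1) (by omega)).1 hx'
    exact (mem_coboundaries (n - 1) (by omega)).2 ⟨f.toFun _ y, (f.map_d _ _ _ _).symm⟩)

theorem cohomologyMap_mk {A B : DGAlg.{v} k} (f : A ⟶ B) (n : ℤ) (x : A.cocycles n) :
    cohomologyMap f n (Submodule.Quotient.mk x) = Submodule.Quotient.mk (cocyclesMap f n x) := rfl

variable (k) in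
/-- The cohomology functor from dg-algebras to (dg-)algebras. -/
def cohomologyFunctor : DGAlg.{v} k ⥤ DGAlg.{v} k where
  obj A := A.cohomologyAlg
  map {A B} f :=
    { toFun := cohomologyMap f
      map_d := fun _ _ _ _ => map_zero _
      map_mul := fun p q n h x y => by
        induction x using Submodule.Quotient.induction_on
        induction y using Submodule.Quotient.induction_on
        exact congrArg Submodule.Quotient.mk (Subtype.ext (f.map_mul p q n h _ _))
      map_one := congrArg Submodule.Quotient.mk (Subtype.ext f.map_one :
        cocyclesMap f 0 ⟨A.one, A.d_one _ _⟩ = ⟨B.one, B.d_one _ _⟩) }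
  map_id A := by
    refine hom_ext fun n => LinearMap.ext fun (x : A.cohomology n) => ?_
    induction x using Submodule.Quotient.induction_on
    rfl
  map_comp {A _ _} f g := by
    refine hom_ext fun n => LinearMap.ext fun (x : A.cohomology n) => ?_
    induction x using Submodule.Quotient.induction_on
    rfl

variable (k) in
/-- Quasi-isomorphisms: morphisms inducing bijections on cohomology in every degree. -/
def quasiIso : MorphismProperty (DGAlg.{v} k) :=
  fun _ _ f => ∀ n : ℤ, Function.Bijective (cohomologyMap f n)

variable (k) in
/-- The homotopy category of dg-algebras: quasi-isomorphisms are formally inverted. -/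
abbrev Ho : Type _ := (quasiIso.{v} k).Localization

variable (k) in
/-- The localization functor to the homotopy category. -/
abbrev toHo : DGAlg.{v} k ⥤ Ho.{v} k := (quasiIso.{v} k).Q

end DGAlg

/-! ### Cochains of simplicial sets -/

namespace SSetCochain

open scoped Simplicial

/-- The simplices of degree `n ∈ ℤ` of a simplicial set (there are none for `n < 0`). -/
abbrev Simplices (S : SSet.{u}) (n : ℤ) : Type u :=
  Σ m : {m : ℕ // (m : ℤ) = n}, S _⦋m.1⦌

/-- The front `p`-face `[v_0, …, v_p]` of a simplex `[v_0, …, v_l]`. -/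
def front (S : SSet.{u}) {l : ℕ} (p : ℕ) (h : p ≤ l) (s : S _⦋l⦌) : S _⦋p⦌ :=
  S.map (SimplexCategory.subinterval 0 p (by omega)).op s

/-- The back `q`-face `[v_p, …, v_{p + q}]` of a simplex `[v_0, …, v_l]`, where `l = p + q`. -/
def back (S : SSet.{u}) {l : ℕ} (p q : ℕ) (h : p + q = l) (s : S _⦋l⦌) : S _⦋q⦌ :=
  S.map (SimplexCategory.subinterval p q h.le).op s

theorem map_map (S : SSet.{u}) {a b c b' : ℕ} {f : ⦋a⦌ ⟶ ⦋b⦌} {g : ⦋b⦌ ⟶ ⦋c⦌}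
    {f' : ⦋a⦌ ⟶ ⦋b'⦌} {g' : ⦋b'⦌ ⟶ ⦋c⦌} (h : f ≫ g = f' ≫ g') (s : S _⦋c⦌) :
    S.map f.op (S.map g.op s) = S.map f'.op (S.map g'.op s) := by
  have := congrArg (fun φ : ⦋a⦌ ⟶ ⦋c⦌ => S.map φ.op s) h
  simpa using this

theorem map_map_eq (S : SSet.{u}) {a b c : ℕ} {f : ⦋a⦌ ⟶ ⦋b⦌} {g : ⦋b⦌ ⟶ ⦋c⦌}
    {f' : ⦋a⦌ ⟶ ⦋c⦌} (h : f ≫ g = f') (s : S _⦋c⦌) :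
    S.map f.op (S.map g.op s) = S.map f'.op s := by
  have := congrArg (fun φ : ⦋a⦌ ⟶ ⦋c⦌ => S.map φ.op s) h
  simpa using this

theorem subinterval_apply {n j l : ℕ} (h : j + l ≤ n) (i : Fin (l + 1)) :
    ((SimplexCategory.subinterval j l h).toOrderHom i : ℕ) = i + j := rfl

/-- The values of the `i`-th coface map. -/
def skip (i j : ℕ) : ℕ := if j < i then j else j + 1

theorem δ_apply {n : ℕ} (i : Fin (n + 2)) (j : Fin (n + 1)) :
    ((SimplexCategory.δ i).toOrderHom j : ℕ) = skip i j := by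
  change ((i.succAbove j : Fin _) : ℕ) = _
  simp only [Fin.succAbove, Fin.lt_def, Fin.val_castSucc, skip]
  split_ifs <;> rfl

theorem hom_ext_val {a b : ℕ} {f g : ⦋a⦌ ⟶ ⦋b⦌}
    (h : ∀ i : Fin (a + 1), (f.toOrderHom i : ℕ) = g.toOrderHom i) : f = g :=
  SimplexCategory.Hom.ext _ _ (OrderHom.ext _ _ (funext fun i => Fin.ext (h i)))

theorem comp_apply_val {a b c : ℕ} (f : ⦋a⦌ ⟶ ⦋b⦌) (g : ⦋b⦌ ⟶ ⦋c⦌) (i : Fin (a + 1)) :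
    ((f ≫ g).toOrderHom i : ℕ) = g.toOrderHom (f.toOrderHom i) := rfl

theorem front_δ_of_le (S : SSet.{u}) {l p : ℕ} (h : p ≤ l) (i : Fin (l + 2))
    (j : Fin (p + 2)) (hij : (i : ℕ) = j) (s : S _⦋l + 1⦌) :
    front S p h (S.δ i s) = S.δ j (front S (p + 1) (by omega) s) := by
  refine map_map S (hom_ext_val fun a => ?_) s
  simp only [comp_apply_val, subinterval_apply, δ_apply, hij, add_zero]

theorem front_δ_of_gt (S : SSet.{u}) {l p : ℕ} (h : p ≤ l) (i : Fin (l + 2))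
    (hi : p < i) (s : S _⦋l + 1⦌) :
    front S p h (S.δ i s) = front S p (by omega) s := by
  refine map_map_eq S (hom_ext_val fun a => ?_) s
  simp only [comp_apply_val, subinterval_apply, δ_apply, add_zero]
  exact if_pos (by omega)

theorem back_δ_of_le (S : SSet.{u}) {l p q : ℕ} (h : p + q = l) (i : Fin (l + 2))
    (hi : (i : ℕ) ≤ p) (s : S _⦋l + 1⦌) :
    back S p q h (S.δ i s) = back S (p + 1) q (by omega) s := by
  refine map_map_eq S (hom_ext_val fun a => ?_) s
  simp only [comp_apply_val, subinterval_apply, δ_apply]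
  rw [skip, if_neg (by omega)]
  omega

theorem back_δ_of_ge (S : SSet.{u}) {l p q : ℕ} (h : p + q = l) (i : Fin (l + 2))
    (j : Fin (q + 2)) (hij : (i : ℕ) = p + j) (s : S _⦋l + 1⦌) :
    back S p q h (S.δ i s) = S.δ j (back S p (q + 1) (by omega) s) := by
  refine map_map S (hom_ext_val fun a => ?_) s
  simp only [comp_apply_val, subinterval_apply, δ_apply]
  unfold skip
  split_ifs <;> omega

theorem δ_last_front (S : SSet.{u}) {l p : ℕ} (h : p + 1 ≤ l) (s : S _⦋l⦌) :
    S.δ (Fin.last (p + 1)) (front S (p + 1) h s) = front S p (by omega) s := by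
  refine map_map_eq S (hom_ext_val fun a => ?_) s
  simp only [comp_apply_val, subinterval_apply, δ_apply, Fin.val_last]
  exact if_pos (by omega)

theorem δ_zero_back (S : SSet.{u}) {l p q : ℕ} (h : p + (q + 1) = l) (s : S _⦋l⦌) :
    S.δ 0 (back S p (q + 1) h s) = back S (p + 1) q (by omega) s := by
  refine map_map_eq S (hom_ext_val fun a => ?_) s
  simp only [comp_apply_val, subinterval_apply, δ_apply]
  rw [skip, if_neg (by simp)]
  omega

theorem front_front (S : SSet.{u}) {l p q : ℕ} (h : p ≤ q) (h' : q ≤ l) (s : S _⦋l⦌) :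
    front S p h (front S q h' s) = front S p (h.trans h') s :=
  map_map_eq S (hom_ext_val fun a => by simp only [comp_apply_val, subinterval_apply, add_zero]) s

theorem back_front (S : SSet.{u}) {l p q r : ℕ} (h : p + q = r) (h' : r ≤ l) (t : ℕ)
    (ht : p + t = l) (h'' : q ≤ t) (s : S _⦋l⦌) :
    back S p q h (front S r h' s) = front S q h'' (back S p t ht s) :=
  map_map S (hom_ext_val fun a => by simp only [comp_apply_val, subinterval_apply, add_zero]) s

theorem back_back (S : SSet.{u}) {l p q r t : ℕ} (h : p + t = l) (h' : q + r = t) (s : S _⦋l⦌) :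
    back S q r h' (back S p t h s) = back S (p + q) r (by omega) s :=
  map_map_eq S (hom_ext_val fun a => by
    simp only [comp_apply_val, subinterval_apply]; omega) s

theorem front_self (S : SSet.{u}) {l : ℕ} (h : l ≤ l) (s : S _⦋l⦌) : front S l h s = s := by
  have : SimplexCategory.subinterval 0 l (by omega) = 𝟙 ⦋l⦌ := hom_ext_val fun a => rfl
  simp [front, this]

theorem back_self (S : SSet.{u}) {l : ℕ} (h : 0 + l = l) (s : S _⦋l⦌) : back S 0 l h s = s := by
  have : SimplexCategory.subinterval 0 l (by omega) = 𝟙 ⦋l⦌ := hom_ext_val fun a => rfl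
  simp [back, this]

variable (k : Type w) [Field k]

/-- The cochain differential, dual to the alternating sum of the faces:
`(dφ)(s) = ∑ i, (-1) ^ i φ(δ_i s)`. -/
def d (S : SSet.{u}) (m n : ℤ) (h : m + 1 = n) :
    (Simplices S m → k) →ₗ[k] (Simplices S n → k) where
  toFun φ σ := match σ with
    | ⟨⟨0, _⟩, _⟩ => 0
    | ⟨⟨j + 1, hj⟩, s⟩ =>
      ∑ i : Fin (j + 2), (-1) ^ (i : ℕ) * φ ⟨⟨j, by push_cast at hj; omega⟩, S.δ i s⟩
  map_add' φ ψ := by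
    ext ⟨⟨_ | j, hj⟩, s⟩
    · simp
    · simp [mul_add, Finset.sum_add_distrib]
  map_smul' c φ := by
    ext ⟨⟨_ | j, hj⟩, s⟩
    · simp
    · simp [Finset.mul_sum, mul_left_comm]

/-- The cup product (Alexander-Whitney formula):
`(φ ∪ ψ)[v_0, …, v_{p + q}] = φ[v_0, …, v_p] ψ[v_p, …, v_{p + q}]`. -/
def cup (S : SSet.{u}) (p q n : ℤ) (h : p + q = n) :
    (Simplices S p → k) →ₗ[k] (Simplices S q → k) →ₗ[k] (Simplices S n → k) :=
  LinearMap.mk₂ k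
    (fun φ ψ σ =>
      if hpq : 0 ≤ p ∧ 0 ≤ q then
        φ ⟨⟨p.toNat, by omega⟩, front S p.toNat (by have := σ.1.2; omega) σ.2⟩ *
          ψ ⟨⟨q.toNat, by omega⟩, back S p.toNat q.toNat (by have := σ.1.2; omega) σ.2⟩
      else 0)
    (fun φ φ' ψ => by ext σ; by_cases hpq : 0 ≤ p ∧ 0 ≤ q <;> simp [hpq, add_mul])
    (fun c φ ψ => by ext σ; by_cases hpq : 0 ≤ p ∧ 0 ≤ q <;> simp [hpq, mul_assoc])
    (fun φ ψ ψ' => by ext σ; by_cases hpq : 0 ≤ p ∧ 0 ≤ q <;> simp [hpq, mul_add])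
    (fun c φ ψ => by
      ext σ; by_cases hpq : 0 ≤ p ∧ 0 ≤ q <;> simp [hpq, mul_left_comm])

variable {k}

theorem d_succ (S : SSet.{u}) (m n : ℤ) (h : m + 1 = n) (φ : Simplices S m → k) (j : ℕ)
    (hj : ((j + 1 : ℕ) : ℤ) = n) (s : S _⦋j + 1⦌) :
    d k S m n h φ ⟨⟨j + 1, hj⟩, s⟩ =
      ∑ i : Fin (j + 2), (-1) ^ (i : ℕ) * φ ⟨⟨j, by push_cast at hj; omega⟩, S.δ i s⟩ := rfl

theorem cup_def (S : SSet.{u}) (p q n : ℤ) (h : p + q = n) (φ : Simplices S p → k)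
    (ψ : Simplices S q → k) (σ : Simplices S n) :
    cup k S p q n h φ ψ σ =
      if hpq : 0 ≤ p ∧ 0 ≤ q then
        φ ⟨⟨p.toNat, by omega⟩, front S p.toNat (by have := σ.1.2; omega) σ.2⟩ *
          ψ ⟨⟨q.toNat, by omega⟩, back S p.toNat q.toNat (by have := σ.1.2; omega) σ.2⟩
      else 0 := rfl

theorem cup_apply (S : SSet.{u}) (p q l : ℕ) (n : ℤ) (h : (p : ℤ) + q = n) (hl : (l : ℤ) = n)
    (φ : Simplices S p → k) (ψ : Simplices S q → k) (s : S _⦋l⦌) :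
    cup k S p q n h φ ψ ⟨⟨l, hl⟩, s⟩ =
      φ ⟨⟨p, rfl⟩, front S p (by omega) s⟩ * ψ ⟨⟨q, rfl⟩, back S p q (by omega) s⟩ := by
  have hpq : (0 : ℤ) ≤ p ∧ (0 : ℤ) ≤ q := ⟨by omega, by omega⟩
  rw [cup_def, dif_pos hpq]
  rfl

theorem eq_zero_of_neg {S : SSet.{u}} {n : ℤ} (hn : n < 0) (φ : Simplices S n → k) : φ = 0 := by
  ext ⟨⟨l, hl⟩, s⟩
  omega

theorem d_d (S : SSet.{u}) (l m n : ℤ) (h : l + 1 = m) (h' : m + 1 = n)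
    (φ : Simplices S l → k) : d k S m n h' (d k S l m h φ) = 0 := by
  ext ⟨⟨a, ha⟩, s⟩
  obtain hl | hl := lt_or_ge l 0
  · rw [eq_zero_of_neg hl φ, map_zero, map_zero]
  obtain ⟨a, rfl⟩ : ∃ b, a = b + 1 + 1 := ⟨a - 2, by omega⟩
  rw [d_succ]
  simp only [d_succ, Finset.mul_sum, Pi.zero_apply]
  rw [← Finset.sum_product', Finset.univ_product_univ]
  let T : Finset (Fin (a + 3) × Fin (a + 2)) :=
    Finset.univ.filter fun ij => (ij.1 : ℕ) ≤ (ij.2 : ℕ)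
  rw [← Finset.sum_add_sum_compl T, ← eq_neg_iff_add_eq_zero, ← Finset.sum_neg_distrib]
  let f : ∀ ij : Fin (a + 3) × Fin (a + 2), ij ∈ T → Fin (a + 3) × Fin (a + 2) := fun ij hij =>
    (ij.2.succ, Fin.castLT ij.1 (lt_of_le_of_lt (Finset.mem_filter.mp hij).right ij.2.is_lt))
  refine Finset.sum_bij f ?_ ?_ ?_ ?_
  · intro ij hij
    simp_rw [T, f, Finset.compl_filter, Finset.mem_filter_univ, Fin.val_succ,
      Fin.val_castLT] at hij ⊢
    omega
  · rintro ⟨i, j⟩ hij ⟨i', j'⟩ hij' e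
    simp only [f, Prod.mk.injEq, Fin.ext_iff, Fin.val_succ, Fin.val_castLT] at e ⊢
    omega
  · rintro ⟨i', j'⟩ hij'
    simp_rw [T, Finset.compl_filter, Finset.mem_filter_univ, not_le] at hij'
    refine ⟨(Fin.castSucc j', ⟨i' - 1, by omega⟩), ?_, ?_⟩
    · simp only [T, Finset.mem_filter_univ, Fin.val_castSucc]; omega
    · simp only [f, Prod.mk.injEq, Fin.ext_iff, Fin.val_succ, Fin.val_castLT, Fin.val_castSucc]
      exact ⟨by omega, trivial⟩
  · rintro ⟨i, j⟩ hij
    have hij' : (i : ℕ) ≤ j := by simpa [T] using hij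
    have key : S.δ (Fin.castLT i (lt_of_le_of_lt hij' j.is_lt)) (S.δ j.succ s) =
        S.δ j (S.δ i s) := S.δ_comp_δ''_apply (by simpa [Fin.le_def] using hij') s
    simp only [f, key, Fin.val_succ, Fin.val_castLT]
    ring

theorem leibniz_aux (S : SSet.{u}) (p q l : ℕ) (h : p + q = l) (f : S _⦋p⦌ → k) (g : S _⦋q⦌ → k)
    (s : S _⦋l + 1⦌) :
    ∑ i : Fin (l + 2), (-1) ^ (i : ℕ) *
        (f (front S p (by omega) (S.δ i s)) * g (back S p q h (S.δ i s))) =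
      (∑ i : Fin (p + 2), (-1) ^ (i : ℕ) * f (S.δ i (front S (p + 1) (by omega) s))) *
          g (back S (p + 1) q (by omega) s) +
        (-1) ^ p * (f (front S p (by omega) s) *
          ∑ i : Fin (q + 2), (-1) ^ (i : ℕ) * g (S.δ i (back S p (q + 1) (by omega) s))) := by
  rw [← Fin.sum_congr' _ (show (p + 1) + (q + 1) = l + 2 by omega), Fin.sum_univ_add,
    Fin.sum_univ_castSucc (n := p + 1), Fin.sum_univ_succ (n := q + 1), δ_last_front, δ_zero_back]
  have h₁ : ∀ i : Fin (p + 1),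
      (-1 : k) ^ ((Fin.cast (show (p + 1) + (q + 1) = l + 2 by omega) (Fin.castAdd _ i)) : ℕ) *
        (f (front S p (by omega) (S.δ (Fin.cast (by omega) (Fin.castAdd (q + 1) i)) s)) *
          g (back S p q h (S.δ (Fin.cast (by omega) (Fin.castAdd (q + 1) i)) s))) =
      ((-1) ^ (i.castSucc : ℕ) * f (S.δ i.castSucc (front S (p + 1) (by omega) s))) *
        g (back S (p + 1) q (by omega) s) := by
    intro i
    rw [front_δ_of_le S _ _ i.castSucc (by simp), back_δ_of_le S _ _ (by simp; omega)]
    simp [mul_assoc]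
  have h₂ : ∀ i : Fin (q + 1),
      (-1 : k) ^ ((Fin.cast (show (p + 1) + (q + 1) = l + 2 by omega) (Fin.natAdd _ i)) : ℕ) *
        (f (front S p (by omega) (S.δ (Fin.cast (by omega) (Fin.natAdd (p + 1) i)) s)) *
          g (back S p q h (S.δ (Fin.cast (by omega) (Fin.natAdd (p + 1) i)) s))) =
      (-1) ^ p * (f (front S p (by omega) s) *
        ((-1) ^ (i.succ : ℕ) * g (S.δ i.succ (back S p (q + 1) (by omega) s)))) := by
    intro i
    rw [front_δ_of_gt S _ _ (by simp; omega), back_δ_of_ge S _ _ i.succ (by simp; omega)]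
    simp only [Fin.val_cast, Fin.val_natAdd, Fin.val_succ]
    ring
  rw [Finset.sum_congr rfl fun i _ => h₁ i, Finset.sum_congr rfl fun i _ => h₂ i,
    ← Finset.sum_mul, ← Finset.mul_sum, ← Finset.mul_sum]
  simp only [Fin.val_last, Fin.val_zero]
  ring

/-- The dg-algebra `C^*(S) = Hom_k(k[S], k)` of cochains of a simplicial set `S`, with the
cup product. -/
def alg (k : Type w) [Field k] (S : SSet.{u}) : DGAlg.{max u w} k where
  carrier n := Simplices S n → k
  d := d k S
  mul := cup k S
  one := fun _ => 1
  d_d := d_d S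
  mul_assoc p q r pq qr n hpq hqr h h' φ ψ χ := by
    by_cases hp : p < 0
    · rw [eq_zero_of_neg hp φ]; simp
    by_cases hq : q < 0
    · rw [eq_zero_of_neg hq ψ]; simp
    by_cases hr : r < 0
    · rw [eq_zero_of_neg hr χ]; simp
    lift p to ℕ using by omega
    lift q to ℕ using by omega
    lift r to ℕ using by omega
    obtain rfl : pq = ((p + q : ℕ) : ℤ) := by omega
    obtain rfl : qr = ((q + r : ℕ) : ℤ) := by omega
    ext ⟨⟨l, hl⟩, s⟩
    rw [cup_apply, cup_apply, cup_apply, cup_apply, front_front, back_back,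
      back_front S rfl (by omega) (q + r) (by omega) (by omega), mul_assoc]
  one_mul n h φ := by
    ext ⟨⟨l, hl⟩, s⟩
    subst hl
    refine (cup_apply S 0 l l _ h rfl _ φ s).trans ?_
    rw [back_self, _root_.one_mul]
  mul_one n h φ := by
    ext ⟨⟨l, hl⟩, s⟩
    subst hl
    refine (cup_apply S l 0 l _ h rfl φ _ s).trans ?_
    rw [front_self, _root_.mul_one]
  leibniz p q n p' q' n' h hp hq hn h₁ h₂ φ ψ := by
    by_cases hp0 : p < 0
    · rw [eq_zero_of_neg hp0 φ]; simp
    by_cases hq0 : q < 0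
    · rw [eq_zero_of_neg hq0 ψ]; simp
    lift p to ℕ using by omega
    lift q to ℕ using by omega
    obtain rfl : p' = ((p + 1 : ℕ) : ℤ) := by omega
    obtain rfl : q' = ((q + 1 : ℕ) : ℤ) := by omega
    obtain rfl : n = ((p + q : ℕ) : ℤ) := by omega
    ext ⟨⟨l, hl⟩, s⟩
    obtain ⟨l, rfl⟩ : ∃ b, l = b + 1 := ⟨l - 1, by omega⟩
    have hsign : ((p : ℤ).negOnePow • cup k S p (q + 1 : ℕ) n' h₂ φ (d k S q (q + 1 : ℕ) hq ψ))
        ⟨⟨l + 1, hl⟩, s⟩ =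
        (-1) ^ p * cup k S p (q + 1 : ℕ) n' h₂ φ (d k S q (q + 1 : ℕ) hq ψ) ⟨⟨l + 1, hl⟩, s⟩ := by
      rw [Units.smul_def, Pi.smul_apply, Int.coe_negOnePow_natCast, zsmul_eq_mul]
      push_cast
      rfl
    rw [Pi.add_apply, hsign, d_succ, cup_apply, cup_apply, d_succ, d_succ]
    simp only [cup_apply]
    exact leibniz_aux S p q l (by omega) (fun t => φ ⟨⟨p, rfl⟩, t⟩) (fun t => ψ ⟨⟨q, rfl⟩, t⟩) s

/-- The action of a simplicial map on simplices. -/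
def mapSimplices {S T : SSet.{u}} (f : S ⟶ T) (n : ℤ) (σ : Simplices S n) : Simplices T n :=
  ⟨σ.1, f.app _ σ.2⟩

theorem app_map {S T : SSet.{u}} (f : S ⟶ T) {a b : ℕ} (g : ⦋a⦌ ⟶ ⦋b⦌) (s : S _⦋b⦌) :
    f.app _ (S.map g.op s) = T.map g.op (f.app _ s) :=
  NatTrans.naturality_apply f g.op s

/-- The contravariant functor `S ↦ C^*(S)` from simplicial sets to dg-algebras. -/
def functor (k : Type w) [Field k] : SSet.{u}ᵒᵖ ⥤ DGAlg.{max u w} k where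
  obj S := alg k S.unop
  map {S T} f :=
    { toFun := fun n => LinearMap.funLeft k k (mapSimplices f.unop n)
      map_d := by
        intro m n h (φ : Simplices S.unop m → k)
        refine funext ?_
        rintro ⟨⟨_ | j, hj⟩, s⟩
        · rfl
        · change d k S.unop m n h φ ⟨⟨j + 1, hj⟩, f.unop.app _ s⟩ =
            d k T.unop m n h (fun σ => φ (mapSimplices f.unop m σ)) ⟨⟨j + 1, hj⟩, s⟩
          rw [d_succ, d_succ]
          refine Finset.sum_congr rfl fun i _ => ?_
          congr 2
          exact congrArg (Sigma.mk _) (app_map f.unop (SimplexCategory.δ i) s).symm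
      map_mul := by
        intro p q n h (φ : Simplices S.unop p → k) (ψ : Simplices S.unop q → k)
        refine funext ?_
        rintro ⟨⟨l, hl⟩, s⟩
        change dite _ _ _ = dite _ _ _
        refine dite_congr rfl (fun hpq => ?_) (fun _ => rfl)
        refine congrArg₂ (· * ·) (congrArg φ ?_) (congrArg ψ ?_)
        · exact congrArg (Sigma.mk _) (app_map f.unop _ s).symm
        · exact congrArg (Sigma.mk _) (app_map f.unop _ s).symm
      map_one := rfl }
  map_id S := rfl
  map_comp f g := rfl

end SSetCochain

/-! ### Vietoris-Rips and Čech filtrations -/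

/-- The simplicial set on the vertex set `X` whose `n`-simplices are the tuples
`[x_0, …, x_n]` (repetitions allowed) with `{x_0, …, x_n} ∈ F`, for a family `F` of subsets
of `X` stable under passing to subsets. -/
def vertexComplex {X : Type u} (F : LowerSet (Set X)) : SSet.{u} where
  obj n := {x : Fin (n.unop.len + 1) → X // Set.range x ∈ F}
  map θ := ↾fun x => ⟨x.1 ∘ θ.unop.toOrderHom, F.lower (Set.range_comp_subset_range _ _) x.2⟩
  map_id _ := rfl
  map_comp _ _ := rfl

/-- The inclusion of complexes on the same vertex set. -/
def vertexComplexMap {X : Type u} {F G : LowerSet (Set X)} (h : F ≤ G) :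
    vertexComplex F ⟶ vertexComplex G where
  app _ := ↾fun x => ⟨x.1, h x.2⟩
  naturality _ _ _ := rfl

/-- The filtered simplicial set of an increasing family of complexes on the vertex set `X`. -/
def vertexFiltration {X : Type u} (F : ℝ → LowerSet (Set X)) (hF : Monotone F) :
    ℝ ⥤ SSet.{u} where
  obj a := vertexComplex (F a)
  map h := vertexComplexMap (hF (leOfHom h))
  map_id _ := rfl
  map_comp _ _ := rfl

/-- The simplices of the Vietoris-Rips complex: `σ` such that `d(x, y) ≤ a` for all
`x, y ∈ σ`. -/
def ripsSimplices (X : Type u) [MetricSpace X] (a : ℝ) : LowerSet (Set X) where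
  carrier := {σ | ∀ x ∈ σ, ∀ y ∈ σ, dist x y ≤ a}
  lower' _ _ h hσ x hx y hy := hσ x (h hx) y (h hy)

/-- The Vietoris-Rips filtration of a metric space. -/
def rips (X : Type u) [MetricSpace X] : ℝ ⥤ SSet.{u} :=
  vertexFiltration (ripsSimplices X) fun _ _ h _ hσ x hx y hy => (hσ x hx y hy).trans h

/-- The simplices of the intrinsic Čech complex: `σ` such that the closed balls of radius `a`
around the points of `σ` have a common point in `X`. -/
def cechSimplices (X : Type u) [MetricSpace X] (a : ℝ) : LowerSet (Set X) where
  carrier := {σ | (⋂ x ∈ σ, Metric.closedBall x a).Nonempty}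
  lower' _ _ h hσ := hσ.mono (Set.biInter_subset_biInter_left h)

/-- The intrinsic Čech filtration of a metric space. -/
def cech (X : Type u) [MetricSpace X] : ℝ ⥤ SSet.{u} :=
  vertexFiltration (cechSimplices X) fun _ _ h _ hσ =>
    hσ.mono (Set.iInter₂_mono fun _ _ => Metric.closedBall_subset_closedBall h)

/-! ### Interleavings -/

section Interleaving

variable {C : Type*} [Category C]

/-- The shift `F[ε]` of a copersistent object: `F[ε]^r = F^{r - ε}`. -/
def shift (ε : ℝ) (F : ℝᵒᵖ ⥤ C) : ℝᵒᵖ ⥤ C :=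
  (Monotone.functor (f := fun r : ℝ => r - ε) fun _ _ h => sub_le_sub_right h ε).op ⋙ F

/-- The structural morphism `F^r ⟶ F^s` of a copersistent object, for `s ≤ r`. -/
abbrev structural (F : ℝᵒᵖ ⥤ C) {s r : ℝ} (h : s ≤ r) : F.obj (op r) ⟶ F.obj (op s) :=
  F.map (homOfLE h).op

/-- `F` and `G` are `ε`-interleaved: there are `ε`-morphisms `μ : F ⟶ G[ε]` and
`ν : G ⟶ F[ε]` whose composites are the structural morphisms `F ⟶ F[2ε]` and `G ⟶ G[2ε]`. -/
def Interleaved (ε : ℝ≥0) (F G : ℝᵒᵖ ⥤ C) : Prop :=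
  ∃ (μ : F ⟶ shift ε G) (ν : G ⟶ shift ε F), ∀ r : ℝ,
    μ.app (op r) ≫ ν.app (op (r - ε)) =
        structural F ((sub_le_self _ ε.2).trans (sub_le_self r ε.2)) ∧
      ν.app (op r) ≫ μ.app (op (r - ε)) =
        structural G ((sub_le_self _ ε.2).trans (sub_le_self r ε.2))

/-- The interleaving distance, with values in `[0, ∞]`. -/
noncomputable def interleavingDist (F G : ℝᵒᵖ ⥤ C) : ℝ≥0∞ :=
  ⨅ (ε : ℝ≥0) (_ : Interleaved ε F G), (ε : ℝ≥0∞)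

end Interleaving

/-- `d_{ho(Alg_As)}`: the interleaving distance, in the homotopy category of dg-algebras, between
the cochain algebras of two persistent simplicial sets. -/
noncomputable def distHoAs (k : Type w) [Field k] (K L : ℝ ⥤ SSet.{u}) : ℝ≥0∞ :=
  interleavingDist (K.op ⋙ SSetCochain.functor k ⋙ DGAlg.toHo k)
    (L.op ⋙ SSetCochain.functor k ⋙ DGAlg.toHo k)

/-- `d_As`: the interleaving distance, in the strict category of dg-algebras, between the cup
product algebras on the cohomology of two persistent simplicial sets. -/
noncomputable def distAs (k : Type w) [Field k] (K L : ℝ ⥤ SSet.{u}) : ℝ≥0∞ :=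
  interleavingDist (K.op ⋙ SSetCochain.functor k ⋙ DGAlg.cohomologyFunctor k)
    (L.op ⋙ SSetCochain.functor k ⋙ DGAlg.cohomologyFunctor k)

/-- The distance `d_{ho(Alg_As)}` of two persistent topological spaces, through their singular
cochain algebras. -/
noncomputable def distHoAsTop (k : Type w) [Field k] (K L : ℝ ⥤ TopCat.{u}) : ℝ≥0∞ :=
  distHoAs k (K ⋙ TopCat.toSSet) (L ⋙ TopCat.toSSet)

/-- The distance `d_As` of two persistent topological spaces, through their singular cohomology
algebras. -/
noncomputable def distAsTop (k : Type w) [Field k] (K L : ℝ ⥤ TopCat.{u}) : ℝ≥0∞ :=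
  distAs k (K ⋙ TopCat.toSSet) (L ⋙ TopCat.toSSet)

/-! ### The Gromov-Hausdorff distance -/

/-- A correspondence between `X` and `Y`: a subset of `X × Y` with surjective projections. -/
def IsCorrespondence {X : Type*} {Y : Type*} (C : Set (X × Y)) : Prop :=
  (∀ x, ∃ y, (x, y) ∈ C) ∧ ∀ y, ∃ x, (x, y) ∈ C

/-- The distortion `sup |d_X(x, x') - d_Y(y, y')|` over `(x, y), (x', y') ∈ C`. -/
noncomputable def distortion {X : Type*} {Y : Type*} [MetricSpace X] [MetricSpace Y]
    (C : Set (X × Y)) : ℝ≥0∞ :=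
  ⨆ (p ∈ C) (q ∈ C), ENNReal.ofReal |dist p.1 q.1 - dist p.2 q.2|

/-- The Gromov-Hausdorff distance: half the infimum of the distortions of correspondences
(`∞` if there is no correspondence of finite distortion). -/
noncomputable def gromovHausdorffDist (X : Type*) (Y : Type*) [MetricSpace X] [MetricSpace Y] :
    ℝ≥0∞ :=
  (1 / 2) * ⨅ (C : Set (X × Y)) (_ : IsCorrespondence C), distortion C

/-! A correspondence of distortion `ε` relates points of `X` and `Y` so that passing to related
points changes distances by at most `ε`. Choose partners `f : X → Y` and `g : Y → X`. Both send
simplices at scale `a` to simplices at scale `a + ε` (`transfers_rips`, `transfers_cech`). For a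
simplex `σ` at scale `a`, every point of `σ ∪ g(f(σ))` is related to a point of `f(σ)`, so this
union is a simplex at scale `a + 2ε`, and `g ∘ f` is contiguous to the inclusion
(`Transfers.contiguous`). Hence any contravariant functor that identifies contiguous maps turns `f`
and `g` into an `ε`-interleaving (`interleaved_of_transfers`). The infimum over correspondences
gives `2 d_GH`.

It remains to see that the functors in question identify contiguous maps. Such maps are simplicially
homotopic, and their realizations are homotopic along straight lines, so it suffices that the
functors identify simplicially homotopic maps. On cohomology this is the classical cochain homotopy
(`cohomologyMap_eq_of_homotopy`). In the homotopy category that homotopy is of no direct use, since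
it is not multiplicative. Instead, the projection of the cylinder `S ⊗ Δ[1]` onto `S` is a
quasi-isomorphism, so it becomes invertible, and the two ends of the cylinder, both sections of it,
become equal (`toHo_map_eq`). -/

/-! ### Cochain homotopies -/

namespace SSetCochain

open scoped Simplicial
open AlgebraicTopology

/-- The functor `A ↦ (A → k)`, with values in the opposite category of `k`-vector spaces. -/
def funFunctor (k : Type w) [Field k] : Type u ⥤ (ModuleCat.{max u w} k)ᵒᵖ where
  obj A := op (ModuleCat.of k (A → k))
  map f := (ModuleCat.ofHom (LinearMap.funLeft k k f)).op
  map_id _ := rfl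
  map_comp _ _ := rfl

variable {k : Type w} [Field k] {S T : SSet.{u}} {f g : S ⟶ T}

/-- Evaluation of a morphism `(A → k) → (B → k)` at a function on `A` and a point of `B`. -/
def evalHom (k : Type w) [Field k] {A B : Type u} (φ : A → k) (b : B) :
    ((funFunctor k).obj B ⟶ (funFunctor k).obj A) →+ k where
  toFun q := (q.unop.hom φ : B → k) b
  map_zero' := rfl
  map_add' _ _ := rfl

theorem evalHom_d (S : SSet.{u}) (m : ℕ) (φ : S _⦋m⦌ → k) (s : S _⦋m + 1⦌) :
    evalHom k φ s (((alternatingFaceMapComplex _).obj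
      (((SimplicialObject.whiskering _ _).obj (funFunctor k)).obj S)).d (m + 1) m) =
      ∑ i : Fin (m + 2), (-1) ^ (i : ℕ) * φ (S.δ i s) := by
  rw [alternatingFaceMapComplex_obj_d]
  refine (map_sum (evalHom k φ s) _ _).trans (Finset.sum_congr rfl fun i _ => ?_)
  refine (map_zsmul (evalHom k φ s) _ _).trans ?_
  rw [zsmul_eq_mul]
  push_cast
  rfl

/-- As `A ↦ (A → k)` is contravariant, it makes a simplicial set into a simplicial object of the
opposite category of vector spaces, whose alternating face complex is the cochain complex. The
general chain homotopy attached to a simplicial homotopy then applies. Degree `0` is excluded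
because `h` lowers the degree. -/
theorem exists_cochain_homotopy (k : Type w) [Field k] (H : SimplicialObject.Homotopy f g) (m : ℕ) :
    ∃ h : (T _⦋m + 1⦌ → k) → (S _⦋m⦌ → k), ∀ φ : T _⦋m + 1⦌ → k,
      (∀ t : T _⦋m + 2⦌, ∑ i : Fin (m + 3), (-1) ^ (i : ℕ) * φ (T.δ i t) = 0) →
      ∀ s : S _⦋m + 1⦌, φ (f.app _ s) =
        ∑ i : Fin (m + 2), (-1) ^ (i : ℕ) * h φ (S.δ i s) + φ (g.app _ s) := by
  let hc := (H.whiskerRight (funFunctor k)).toChainHomotopy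
  refine ⟨fun φ => (hc.hom m (m + 1)).unop.hom φ, fun φ hφ s => ?_⟩
  -- Composites are read backwards in the opposite category: the two homotopy terms are the
  -- coboundary of `h φ` and the homotopy applied to the coboundary of `φ`. The latter vanishes on
  -- cocycles.
  have key := hc.comm (m + 1)
  rw [dNext_eq (i' := m) (w := by simp), prevD_eq (j' := m + 2) (w := by simp)] at key
  refine (congrArg (evalHom k φ s) key).trans ?_
  refine (map_add (evalHom k φ s) _ _).trans (congrArg₂ _ ?_ rfl)
  refine (map_add (evalHom k φ s) _ _).trans ?_
  refine (congrArg₂ _ (evalHom_d S m ((hc.hom m (m + 1)).unop.hom φ) s) ?_).trans (add_zero _)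
  have hd : (((alternatingFaceMapComplex _).obj (((SimplicialObject.whiskering _ _).obj
      (funFunctor k)).obj T)).d (m + 2) (m + 1)).unop.hom φ = 0 :=
    funext fun t => (evalHom_d T (m + 1) φ t).trans (hφ t)
  exact (congrArg (fun ψ => (hc.hom (m + 1) (m + 2)).unop.hom ψ s) hd).trans
    (congrFun (map_zero (hc.hom (m + 1) (m + 2)).unop.hom) s)

/-- The edge `H.h 0 s` joins the two images of the vertex `s`, and a `0`-cocycle is constant along
edges. -/
theorem apply_eq_of_cocycle_zero (k : Type w) [Field k] (H : SimplicialObject.Homotopy f g)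
    (φ : T _⦋0⦌ → k) (hφ : ∀ t : T _⦋1⦌, ∑ i : Fin 2, (-1) ^ (i : ℕ) * φ (T.δ i t) = 0)
    (s : S _⦋0⦌) : φ (f.app _ s) = φ (g.app _ s) := by
  have h := hφ (H.h 0 s)
  have h0 : T.δ 0 (H.h 0 s) = g.app _ s := ConcreteCategory.congr_hom (H.h_zero_comp_δ_zero 0) s
  have h1 : T.δ 1 (H.h 0 s) = f.app _ s := ConcreteCategory.congr_hom (H.h_last_comp_δ_last 0) s
  rw [Fin.sum_univ_two, h0, h1] at h
  simp only [Fin.val_zero, Fin.val_one, pow_zero, pow_one] at h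
  linear_combination -h

theorem exists_d_eq_of_homotopy (H : SimplicialObject.Homotopy f g) (n : ℤ)
    (φ : Simplices T n → k) (hφ : d k T n (n + 1) rfl φ = 0) :
    ∃ ψ : Simplices S (n - 1) → k, d k S (n - 1) n (sub_add_cancel n 1) ψ =
      fun σ => φ (mapSimplices f n σ) - φ (mapSimplices g n σ) := by
  rcases lt_or_ge n 0 with hn | hn
  · exact ⟨0, by rw [map_zero, eq_zero_of_neg hn φ]; funext σ; simp⟩
  obtain ⟨_ | m, rfl⟩ := Int.eq_ofNat_of_zero_le hn
  · refine ⟨0, ?_⟩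
    rw [map_zero]
    ext ⟨⟨l, hl⟩, s⟩
    obtain rfl : l = 0 := by omega
    exact (sub_eq_zero.2 (apply_eq_of_cocycle_zero k H (fun t => φ ⟨⟨0, rfl⟩, t⟩)
      (fun t => congrFun hφ ⟨⟨1, rfl⟩, t⟩) s)).symm
  · obtain ⟨h, hh⟩ := exists_cochain_homotopy k H m
    -- The simplex `σ` has integer degree `m + 1 - 1`; the cast identifies its dimension with `m`.
    refine ⟨fun σ => h (fun t => φ ⟨⟨m + 1, rfl⟩, t⟩) (cast (by
        obtain ⟨⟨l, hl⟩, s⟩ := σ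
        obtain rfl : l = m := by push_cast at hl; omega
        rfl) σ.2), ?_⟩
    ext ⟨⟨l, hl⟩, s⟩
    obtain rfl : l = m + 1 := by omega
    refine eq_sub_of_add_eq (hh (fun t => φ ⟨⟨m + 1, rfl⟩, t⟩) ?_ s).symm
    exact fun t => congrFun hφ ⟨⟨m + 2, by push_cast; ring⟩, t⟩

theorem cohomologyMap_eq_of_homotopy (H : SimplicialObject.Homotopy f g) (n : ℤ) :
    DGAlg.cohomologyMap ((functor k).map f.op) n =
      DGAlg.cohomologyMap ((functor k).map g.op) n := by
  refine LinearMap.ext fun x => ?_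
  obtain ⟨⟨φ, hφ⟩, rfl⟩ := Submodule.Quotient.mk_surjective _ x
  rw [DGAlg.cohomologyMap_mk, DGAlg.cohomologyMap_mk, Submodule.Quotient.eq]
  exact exists_d_eq_of_homotopy H n φ hφ

end SSetCochain

/-! ### Homotopy invariance -/

section HomotopyInvariance

open scoped Simplicial MonoidalCategory
open CartesianMonoidalCategory

/-- The map `Δ[1] ⊗ Δ[1] ⟶ Δ[1]` taking the minimum of vertices. -/
def stdSimplexOneMin : (Δ[1] ⊗ Δ[1] : SSet.{u}) ⟶ Δ[1] where
  app _ := ↾fun x => SSet.stdSimplex.objMk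
    (SSet.stdSimplex.asOrderHom x.1 ⊓ SSet.stdSimplex.asOrderHom x.2)
  naturality _ _ _ := rfl

/-- The cylinder `S ⊗ Δ[1]` contracts onto its end `0`. -/
noncomputable def cylinderContraction (S : SSet.{u}) :
    SSet.Homotopy (fst S Δ[1] ≫ SSet.ι₀) (𝟙 (S ⊗ Δ[1])) where
  -- This is `(s, t, u) ↦ (s, min t u)`: the end `0` at `u = 0`, the identity at `u = 1`.
  h := (α_ S Δ[1] Δ[1]).hom ≫ S ◁ stdSimplexOneMin
  h₀ := by
    ext n ⟨s, t⟩
    · rfl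
    · exact SSet.stdSimplex.objEquiv.injective (SimplexCategory.Hom.ext _ _ (OrderHom.ext _ _
        (funext fun i => min_eq_right (Fin.zero_le (SSet.stdSimplex.asOrderHom t i)))))
  h₁ := by
    ext n ⟨s, t⟩
    · rfl
    · exact SSet.stdSimplex.objEquiv.injective (SimplexCategory.Hom.ext _ _ (OrderHom.ext _ _
        (funext fun i => min_eq_left (Fin.le_last (SSet.stdSimplex.asOrderHom t i)))))
  -- The homotopy is relative to the empty subcomplex, so there is nothing to check.
  rel := by ext _ ⟨⟨_, ⟨⟩⟩, _⟩

theorem cohomologyFunctor_map_eq {k : Type w} [Field k] {S T : SSet.{u}} {f g : S ⟶ T}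
    (H : SSet.Homotopy f g) :
    (SSetCochain.functor k ⋙ DGAlg.cohomologyFunctor k).map f.op =
      (SSetCochain.functor k ⋙ DGAlg.cohomologyFunctor k).map g.op :=
  DGAlg.hom_ext fun n =>
    SSetCochain.cohomologyMap_eq_of_homotopy H.toSimplicialObjectHomotopy n

theorem quasiIso_of_isIso_cohomology {k : Type w} [Field k] {A B : DGAlg.{v} k} (f : A ⟶ B)
    (h : IsIso ((DGAlg.cohomologyFunctor k).map f)) : DGAlg.quasiIso k f := fun n => by
  have h₁ := congrArg (fun q => DGAlg.Hom.toFun q n)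
    (IsIso.hom_inv_id ((DGAlg.cohomologyFunctor k).map f))
  have h₂ := congrArg (fun q => DGAlg.Hom.toFun q n)
    (IsIso.inv_hom_id ((DGAlg.cohomologyFunctor k).map f))
  exact Function.bijective_iff_has_inverse.2
    ⟨(inv ((DGAlg.cohomologyFunctor k).map f)).toFun n, fun x => LinearMap.congr_fun h₁ x,
      fun x => LinearMap.congr_fun h₂ x⟩

/-- On cohomology the inverse is induced by `ι₀`: one composite is the identity already on
simplicial sets, the other is homotopic to it by `cylinderContraction`. -/
theorem quasiIso_cylinder (k : Type w) [Field k] (S : SSet.{u}) :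
    DGAlg.quasiIso k ((SSetCochain.functor k).map (fst S Δ[1]).op) := by
  refine quasiIso_of_isIso_cohomology _
    ⟨(SSetCochain.functor k ⋙ DGAlg.cohomologyFunctor k).map SSet.ι₀.op, ?_, ?_⟩
  · rw [← Functor.comp_map, ← Functor.map_comp, ← op_comp, SSet.ι₀_fst, op_id,
      CategoryTheory.Functor.map_id]
    rfl
  · rw [← Functor.comp_map, ← Functor.map_comp, ← op_comp,
      cohomologyFunctor_map_eq (cylinderContraction S), op_id, CategoryTheory.Functor.map_id]
    rfl

/-- Only the inversion of the cylinder projection is used, so no notion of homotopy between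
dg-algebra morphisms is needed. -/
theorem toHo_map_eq {k : Type w} [Field k] {S T : SSet.{u}} {f g : S ⟶ T}
    (H : SSet.Homotopy f g) :
    (SSetCochain.functor k ⋙ DGAlg.toHo k).map f.op =
      (SSetCochain.functor k ⋙ DGAlg.toHo k).map g.op := by
  set Φ := SSetCochain.functor k ⋙ DGAlg.toHo k
  have : IsIso (Φ.map (fst S Δ[1]).op) :=
    Localization.inverts (DGAlg.toHo k) (DGAlg.quasiIso k) _ (quasiIso_cylinder k S)
  -- Both ends are sections of the projection, whose image under `Φ` can be cancelled.
  have hι : Φ.map (SSet.ι₀ (X := S)).op = Φ.map SSet.ι₁.op := by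
    rw [← cancel_epi (Φ.map (fst S Δ[1]).op), ← Functor.map_comp, ← Functor.map_comp, ← op_comp,
      ← op_comp, SSet.ι₀_fst, SSet.ι₁_fst]
  calc Φ.map f.op = Φ.map (SSet.ι₀ ≫ H.h).op := by rw [H.h₀]
    _ = Φ.map (SSet.ι₁ ≫ H.h).op := by
      rw [op_comp, op_comp, Functor.map_comp, Functor.map_comp, hι]
    _ = Φ.map g.op := by rw [H.h₁]

end HomotopyInvariance

/-! ### Contiguous maps of vertex complexes -/

section Contiguous

open scoped Simplicial

variable {X Y : Type u} {F : LowerSet (Set X)} {G : LowerSet (Set Y)}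

/-- The simplicial map induced by a map of vertices. -/
def vertexMap (F : LowerSet (Set X)) (G : LowerSet (Set Y)) (f : X → Y)
    (hf : ∀ σ ∈ F, f '' σ ∈ G) : vertexComplex F ⟶ vertexComplex G where
  app _ := ↾fun x => ⟨f ∘ x.1, by rw [Set.range_comp]; exact hf _ x.2⟩
  naturality _ _ _ := rfl

variable (F G) in
/-- Maps of vertices `f` and `g` such that `f(σ) ∪ g(σ)` is a simplex for every simplex `σ`. -/
def Contiguous (f g : X → Y) : Prop :=
  ∀ σ ∈ F, f '' σ ∪ g '' σ ∈ G

theorem Contiguous.left {f g : X → Y} (h : Contiguous F G f g) (σ : Set X) (hσ : σ ∈ F) :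
    f '' σ ∈ G :=
  G.lower Set.subset_union_left (h σ hσ)

theorem Contiguous.right {f g : X → Y} (h : Contiguous F G f g) (σ : Set X) (hσ : σ ∈ F) :
    g '' σ ∈ G :=
  G.lower Set.subset_union_right (h σ hσ)

/-- Contiguous maps are simplicially homotopic. -/
noncomputable def Contiguous.homotopy {f g : X → Y} (h : Contiguous F G f g) :
    SSet.Homotopy (vertexMap F G f h.left) (vertexMap F G g h.right) where
  h :=
    { app _ := ↾fun x =>
        ⟨fun i => if SSet.stdSimplex.asOrderHom x.2 i = 0 then f (x.1.1 i) else g (x.1.1 i), by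
          -- Each vertex is `f x_i` or `g x_i`, so the tuple lies in `f(σ) ∪ g(σ)`, a simplex by
          -- contiguity.
          refine G.lower ?_ (h _ x.1.2)
          rintro _ ⟨i, rfl⟩
          dsimp only
          split_ifs
          · exact Or.inl ⟨_, ⟨i, rfl⟩, rfl⟩
          · exact Or.inr ⟨_, ⟨i, rfl⟩, rfl⟩⟩
      naturality _ _ _ := rfl }
  h₀ := rfl
  h₁ := rfl
  rel := by ext _ ⟨⟨_, ⟨⟩⟩, _⟩

/-! ### Straight-line homotopies between geometric realizations. -/

/-- The continuous map `|[x_0, …, x_n]|` from the standard simplex to the geometric realization of a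
vertex complex. -/
noncomputable def realizedSimplex (G : LowerSet (Set Y)) {n : ℕ} (y : Fin (n + 1) → Y)
    (hy : Set.range y ∈ G) :
    C(stdSimplex ℝ (Fin (n + 1)), SSet.toTop.obj (vertexComplex G)) :=
  TopCat.toSSetObjEquiv _ (op ⦋n⦌) ((sSetTopAdj.unit.app (vertexComplex G)).app (op ⦋n⦌) ⟨y, hy⟩)

/-- This is the naturality of the adjunction unit `K ⟶ Sing |K|` with respect to `θ`. -/
theorem realizedSimplex_map {m n : ℕ} {y : Fin (n + 1) → Y} (hy : Set.range y ∈ G)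
    {θ : Fin (m + 1) → Fin (n + 1)} (hθ : Monotone θ) {y' : Fin (m + 1) → Y}
    (hy' : Set.range y' ∈ G) (e : y ∘ θ = y') (z : stdSimplex ℝ (Fin (m + 1))) :
    realizedSimplex G y hy (stdSimplex.map θ z) = realizedSimplex G y' hy' z := by
  subst e
  have h := NatTrans.naturality_apply (sSetTopAdj.unit.app (vertexComplex G))
    (Quiver.Hom.op (SimplexCategory.Hom.mk ⟨θ, hθ⟩ : ⦋m⦌ ⟶ ⦋n⦌))
    (⟨y, hy⟩ : (vertexComplex G).obj (op ⦋n⦌))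
  exact congrArg (fun s => TopCat.toSSetObjEquiv _ (op ⦋m⦌) s z) h.symm

/-- The point `((1 - t) z, t z)` of the join of two copies of a simplex. -/
noncomputable def joinPoint {n : ℕ} (t : unitInterval) (z : stdSimplex ℝ (Fin n)) :
    stdSimplex ℝ (Fin (n + n)) :=
  ⟨(1 - (t : ℝ)) • (stdSimplex.map (Fin.castAdd n) z : Fin (n + n) → ℝ) +
      (t : ℝ) • (stdSimplex.map (Fin.natAdd n) z : Fin (n + n) → ℝ),
    convex_stdSimplex ℝ _ (stdSimplex.map (Fin.castAdd n) z).2 (stdSimplex.map (Fin.natAdd n) z).2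
      (sub_nonneg.2 t.2.2) t.2.1 (by ring)⟩

theorem coe_joinPoint {n : ℕ} (t : unitInterval) (z : stdSimplex ℝ (Fin n)) :
    (joinPoint t z : Fin (n + n) → ℝ) =
      (1 - (t : ℝ)) • (stdSimplex.map (Fin.castAdd n) z : Fin (n + n) → ℝ) +
        (t : ℝ) • (stdSimplex.map (Fin.natAdd n) z : Fin (n + n) → ℝ) := rfl

theorem joinPoint_zero {n : ℕ} (z : stdSimplex ℝ (Fin n)) :
    joinPoint 0 z = stdSimplex.map (Fin.castAdd n) z := by
  refine Subtype.ext ?_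
  change (1 - (0 : ℝ)) • _ + (0 : ℝ) • _ = _
  rw [sub_zero, one_smul, zero_smul, add_zero]
  rfl

theorem joinPoint_one {n : ℕ} (z : stdSimplex ℝ (Fin n)) :
    joinPoint 1 z = stdSimplex.map (Fin.natAdd n) z := by
  refine Subtype.ext ?_
  change (1 - (1 : ℝ)) • _ + (1 : ℝ) • _ = _
  rw [sub_self, one_smul, zero_smul, zero_add]
  rfl

theorem continuous_joinPoint (n : ℕ) :
    Continuous fun p : stdSimplex ℝ (Fin n) × unitInterval => joinPoint p.2 p.1 := by
  have h (e : Fin n → Fin (n + n)) : Continuous fun p : stdSimplex ℝ (Fin n) × unitInterval =>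
      (stdSimplex.map e p.1 : Fin (n + n) → ℝ) :=
    continuous_subtype_val.comp ((stdSimplex.continuous_map e).comp continuous_fst)
  have ht : Continuous fun p : stdSimplex ℝ (Fin n) × unitInterval => (p.2 : ℝ) :=
    continuous_subtype_val.comp continuous_snd
  exact Continuous.subtype_mk (((continuous_const.sub ht).smul (h _)).add (ht.smul (h _))) _

/-- The map `θ ⋆ θ` between joins. -/
def joinMap {m n : ℕ} (θ : Fin m → Fin n) : Fin (m + m) → Fin (n + n) :=
  Fin.append (Fin.castAdd n ∘ θ) (Fin.natAdd n ∘ θ)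

theorem joinMap_castAdd {m n : ℕ} (θ : Fin m → Fin n) (i : Fin m) :
    joinMap θ (Fin.castAdd m i) = Fin.castAdd n (θ i) :=
  Fin.append_left _ _ i

theorem joinMap_natAdd {m n : ℕ} (θ : Fin m → Fin n) (i : Fin m) :
    joinMap θ (Fin.natAdd m i) = Fin.natAdd n (θ i) :=
  Fin.append_right _ _ i

theorem monotone_joinMap {m n : ℕ} {θ : Fin m → Fin n} (hθ : Monotone θ) :
    Monotone (joinMap θ) := by
  intro i j h
  induction i using Fin.addCases with
  | left i =>
    induction j using Fin.addCases with
    | left j =>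
      rw [joinMap_castAdd, joinMap_castAdd]
      exact hθ (show i ≤ j from h)
    | right j =>
      simp only [joinMap_castAdd, joinMap_natAdd, Fin.le_def, Fin.val_castAdd, Fin.val_natAdd]
      omega
  | right i =>
    induction j using Fin.addCases with
    | left j =>
      simp only [Fin.le_def, Fin.val_castAdd, Fin.val_natAdd] at h
      omega
    | right j =>
      rw [joinMap_natAdd, joinMap_natAdd]
      exact Nat.add_le_add_left (hθ (Nat.le_of_add_le_add_left h : i ≤ j)) n

/-- Pushforward of barycentric coordinates is linear, and `θ ⋆ θ` restricts to `θ` on each of the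
two copies. -/
theorem map_joinMap_joinPoint {m n : ℕ} (θ : Fin m → Fin n) (t : unitInterval)
    (z : stdSimplex ℝ (Fin m)) :
    stdSimplex.map (joinMap θ) (joinPoint t z) = joinPoint t (stdSimplex.map θ z) := by
  have h₁ : joinMap θ ∘ Fin.castAdd m = Fin.castAdd n ∘ θ :=
    funext fun i => joinMap_castAdd θ i
  have h₂ : joinMap θ ∘ Fin.natAdd m = Fin.natAdd n ∘ θ :=
    funext fun i => joinMap_natAdd θ i
  have e₁ := stdSimplex.map_comp_apply (Fin.castAdd m) (joinMap θ) z
  have e₂ := stdSimplex.map_comp_apply (Fin.natAdd m) (joinMap θ) z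
  rw [h₁, ← stdSimplex.map_comp_apply] at e₁
  rw [h₂, ← stdSimplex.map_comp_apply] at e₂
  refine stdSimplex.ext ?_
  rw [stdSimplex.map_coe, coe_joinPoint, coe_joinPoint, map_add, map_smul, map_smul,
    ← stdSimplex.map_coe, ← stdSimplex.map_coe, e₁, e₂]

theorem Contiguous.range_append_mem {f g : X → Y} (h : Contiguous F G f g) {n : ℕ} (x : Fin n → X)
    (hx : Set.range x ∈ F) : Set.range (Fin.append (f ∘ x) (g ∘ x)) ∈ G := by
  refine G.lower ?_ (h _ hx)
  rintro _ ⟨i, rfl⟩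
  induction i using Fin.addCases with
  | left i => exact Or.inl ⟨x i, ⟨i, rfl⟩, (Fin.append_left (f ∘ x) (g ∘ x) i).symm⟩
  | right i => exact Or.inr ⟨x i, ⟨i, rfl⟩, (Fin.append_right (f ∘ x) (g ∘ x) i).symm⟩

/-- The straight-line homotopy in `|[f x_0, …, f x_n, g x_0, …, g x_n]|`. -/
noncomputable def Contiguous.simplexHomotopy {f g : X → Y} (h : Contiguous F G f g) {n : ℕ}
    (x : Fin (n + 1) → X) (hx : Set.range x ∈ F) :
    C(stdSimplex ℝ (Fin (n + 1)), C(unitInterval, SSet.toTop.obj (vertexComplex G))) :=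
  -- The dimension `n + 1 + n` makes the vertex set definitionally `Fin ((n + 1) + (n + 1))`, as
  -- `Fin.append` requires.
  ContinuousMap.curry ((realizedSimplex G (n := n + 1 + n)
    (Fin.append (m := n + 1) (n := n + 1) (f ∘ x) (g ∘ x)) (h.range_append_mem x hx)).comp
      ⟨_, continuous_joinPoint (n + 1)⟩)

/-- Compatibility with all simplicial operators is what lets the homotopies on single simplices
glue. -/
theorem Contiguous.simplexHomotopy_map {f g : X → Y} (h : Contiguous F G f g) {m n : ℕ}
    (x : Fin (n + 1) → X) (hx : Set.range x ∈ F) {θ : Fin (m + 1) → Fin (n + 1)} (hθ : Monotone θ)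
    (hx' : Set.range (x ∘ θ) ∈ F) (z : stdSimplex ℝ (Fin (m + 1))) :
    h.simplexHomotopy x hx (stdSimplex.map θ z) = h.simplexHomotopy (x ∘ θ) hx' z := by
  refine ContinuousMap.ext fun t => ?_
  refine (congrArg _ (map_joinMap_joinPoint θ t z).symm).trans
    (realizedSimplex_map (m := m + 1 + m) (n := n + 1 + n) (h.range_append_mem x hx)
      (monotone_joinMap hθ) (h.range_append_mem _ hx') ?_ (joinPoint t z))
  funext i
  change Fin (m + 1 + (m + 1)) at i
  change Fin.append (m := n + 1) (n := n + 1) (f ∘ x) (g ∘ x) (joinMap θ i) = _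
  induction i using Fin.addCases with
  | left i =>
    rw [joinMap_castAdd]
    exact (Fin.append_left _ _ _).trans (Fin.append_left (f ∘ x ∘ θ) (g ∘ x ∘ θ) i).symm
  | right i =>
    rw [joinMap_natAdd]
    exact (Fin.append_right _ _ _).trans (Fin.append_right (f ∘ x ∘ θ) (g ∘ x ∘ θ) i).symm

theorem Contiguous.simplexHomotopy_zero {f g : X → Y} (h : Contiguous F G f g) {n : ℕ}
    (x : Fin (n + 1) → X) (hx : Set.range x ∈ F) (hfx : Set.range (f ∘ x) ∈ G)
    (z : stdSimplex ℝ (Fin (n + 1))) :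
    h.simplexHomotopy x hx z 0 = realizedSimplex G (f ∘ x) hfx z :=
  (congrArg _ (joinPoint_zero z)).trans
    (realizedSimplex_map (m := n) (n := n + 1 + n) (h.range_append_mem x hx)
      (θ := Fin.castAdd (n + 1)) (fun _ _ h => h) hfx
      (funext fun i => Fin.append_left (f ∘ x) (g ∘ x) i) z)

theorem Contiguous.simplexHomotopy_one {f g : X → Y} (h : Contiguous F G f g) {n : ℕ}
    (x : Fin (n + 1) → X) (hx : Set.range x ∈ F) (hgx : Set.range (g ∘ x) ∈ G)
    (z : stdSimplex ℝ (Fin (n + 1))) :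
    h.simplexHomotopy x hx z 1 = realizedSimplex G (g ∘ x) hgx z :=
  (congrArg _ (joinPoint_one z)).trans
    (realizedSimplex_map (m := n) (n := n + 1 + n) (h.range_append_mem x hx)
      (θ := Fin.natAdd (n + 1)) (fun _ _ h => Nat.add_le_add_left h (n + 1)) hgx
      (funext fun i => Fin.append_right (f ∘ x) (g ∘ x) i) z)

/-- The map to the singular set of the path space which assembles the straight-line homotopies. -/
noncomputable def Contiguous.toPathSpace {f g : X → Y} (h : Contiguous F G f g) :
    vertexComplex F ⟶
      TopCat.toSSet.obj (TopCat.of C(unitInterval, SSet.toTop.obj (vertexComplex G))) where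
  app n := ↾fun x => (TopCat.toSSetObjEquiv _ n).symm (h.simplexHomotopy x.1 x.2)
  naturality m n θ := by
    ext x
    refine (TopCat.toSSetObjEquiv _ n).injective (ContinuousMap.ext fun z => ?_)
    exact (h.simplexHomotopy_map x.1 x.2 θ.unop.toOrderHom.monotone
      (F.lower (Set.range_comp_subset_range _ _) x.2) z).symm

/-- Evaluation of paths. -/
noncomputable def evalPath (Z : TopCat.{u}) (t : unitInterval) :
    TopCat.of C(unitInterval, Z) ⟶ Z :=
  TopCat.ofHom ⟨fun γ => γ t, continuous_eval_const t⟩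

/-- The map from the geometric realization to the path space. -/
noncomputable def Contiguous.realizationToPathSpace {f g : X → Y} (h : Contiguous F G f g) :
    SSet.toTop.obj (vertexComplex F) ⟶
      TopCat.of C(unitInterval, SSet.toTop.obj (vertexComplex G)) :=
  -- Homotopies are curried into the path space because maps out of a realization are given by the
  -- adjunction; a product of a realization with the interval never has to be described.
  (sSetTopAdj.homEquiv _ _).symm h.toPathSpace

/-- Maps out of a realization agree once their adjuncts agree on every simplex. Leaving `f'` and `t`
free covers both ends of the homotopy. -/
theorem Contiguous.realizationToPathSpace_eval {f g f' : X → Y} (h : Contiguous F G f g)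
    (hf' : ∀ σ ∈ F, f' '' σ ∈ G) (t : unitInterval)
    (ht : ∀ (n : ℕ) (x : Fin (n + 1) → X) (hx : Set.range x ∈ F) (hfx : Set.range (f' ∘ x) ∈ G)
      (z : stdSimplex ℝ (Fin (n + 1))),
      h.simplexHomotopy x hx z t = realizedSimplex G (f' ∘ x) hfx z) :
    h.realizationToPathSpace ≫ evalPath _ t = SSet.toTop.map (vertexMap F G f' hf') := by
  refine (sSetTopAdj.homEquiv _ _).injective ?_
  rw [Adjunction.homEquiv_naturality_right, realizationToPathSpace, Equiv.apply_symm_apply,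
    Adjunction.homEquiv_unit]
  refine Eq.trans ?_ (sSetTopAdj.unit.naturality (vertexMap F G f' hf'))
  ext n x
  refine (TopCat.toSSetObjEquiv _ n).injective (ContinuousMap.ext fun z => ?_)
  exact ht n.unop.len x.1 x.2 _ z

/-- The geometric realizations of contiguous maps are homotopic. -/
noncomputable def Contiguous.topHomotopy {f g : X → Y} (h : Contiguous F G f g) :
    TopCat.Homotopy (SSet.toTop.map (vertexMap F G f h.left))
      (SSet.toTop.map (vertexMap F G g h.right)) where
  toFun p := h.realizationToPathSpace p.2 p.1
  continuous_toFun := by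
    have : Continuous fun p : unitInterval × SSet.toTop.obj (vertexComplex F) =>
        h.realizationToPathSpace p.2 :=
      h.realizationToPathSpace.hom.continuous.comp continuous_snd
    -- Joint continuity of evaluation holds because the interval is locally compact.
    exact ContinuousEval.continuous_eval.comp (this.prodMk continuous_fst)
  map_zero_left x := ConcreteCategory.congr_hom (h.realizationToPathSpace_eval h.left 0
    fun _ x hx hfx z => h.simplexHomotopy_zero x hx hfx z) x
  map_one_left x := ConcreteCategory.congr_hom (h.realizationToPathSpace_eval h.right 1
    fun _ x hx hfx z => h.simplexHomotopy_one x hx hfx z) x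

end Contiguous

/-! ### Interleavings from correspondences -/

section Stability

variable {X Y : Type u} {C : Type*} [Category C]

/-- A functor on simplicial sets identifies contiguous maps of vertex complexes. -/
def IdentifiesContiguous (Φ : SSet.{u}ᵒᵖ ⥤ C) : Prop :=
  ∀ ⦃X Y : Type u⦄ (F : LowerSet (Set X)) (G : LowerSet (Set Y)) (f g : X → Y)
    (h : Contiguous F G f g),
    Φ.map (vertexMap F G f h.left).op = Φ.map (vertexMap F G g h.right).op

/-- Every set related to a simplex of `F a` is a simplex of `G b`, if `a + ε ≤ b`. -/
def Transfers (R : X → Y → Prop) (ε : ℝ) (F : ℝ → LowerSet (Set X)) (G : ℝ → LowerSet (Set Y)) :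
    Prop :=
  ∀ ⦃a b : ℝ⦄, a + ε ≤ b → ∀ σ ∈ F a, ∀ τ : Set Y, (∀ y ∈ τ, ∃ x ∈ σ, R x y) → τ ∈ G b

variable {R : X → Y → Prop} {ε : ℝ} {F : ℝ → LowerSet (Set X)} {G : ℝ → LowerSet (Set Y)}

theorem Transfers.image_mem (h : Transfers R ε F G) {f : X → Y} (hf : ∀ x, R x (f x)) {a b : ℝ}
    (hab : a + ε ≤ b) (σ : Set X) (hσ : σ ∈ F a) : f '' σ ∈ G b :=
  h hab σ hσ _ (by rintro _ ⟨x, hx, rfl⟩; exact ⟨x, hx, hf x⟩)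

/-- Both `x` and `g (f x)` are related to `f x`, so a single transfer back from `f(σ)` reaches the
whole union. -/
theorem Transfers.contiguous (h : Transfers R ε F G) (h' : Transfers (Function.swap R) ε G F)
    {f : X → Y} {g : Y → X} (hf : ∀ x, R x (f x)) (hg : ∀ y, R (g y) y) {a b : ℝ}
    (hab : a + ε + ε ≤ b) : Contiguous (F a) (F b) (g ∘ f) id := fun σ hσ =>
  h' hab (f '' σ) (h.image_mem hf le_rfl σ hσ) _ (by
    rintro _ (⟨x, hx, rfl⟩ | ⟨x, hx, rfl⟩)
    · exact ⟨f x, ⟨x, hx, rfl⟩, hg (f x)⟩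
    · exact ⟨f x, ⟨x, hx, rfl⟩, hf x⟩)

theorem vertexMap_sub_add {ε : ℝ} {f : X → Y} (hf : ∀ a b, a + ε ≤ b → ∀ σ ∈ F a, f '' σ ∈ G b)
    (r : ℝ) (σ : Set X) (hσ : σ ∈ F (r - ε)) : f '' σ ∈ G r :=
  hf _ _ (sub_add_cancel _ _).le σ hσ

/-- The shifted morphism of copersistent objects induced by a map of vertices. -/
def interleavingMap (Φ : SSet.{u}ᵒᵖ ⥤ C) {F : ℝ → LowerSet (Set X)} {G : ℝ → LowerSet (Set Y)}
    (hF : Monotone F) (hG : Monotone G) (ε : ℝ) (f : X → Y)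
    (hf : ∀ a b, a + ε ≤ b → ∀ σ ∈ F a, f '' σ ∈ G b) :
    (vertexFiltration G hG).op ⋙ Φ ⟶ shift ε ((vertexFiltration F hF).op ⋙ Φ) where
  app r := Φ.map (vertexMap (F (r.unop - ε)) (G r.unop) f (vertexMap_sub_add hf _)).op
  naturality r s i := by
    have e : vertexMap _ _ f (vertexMap_sub_add hf s.unop) ≫ vertexComplexMap (hG (leOfHom i.unop)) =
        vertexComplexMap (hF (sub_le_sub_right (leOfHom i.unop) ε)) ≫
          vertexMap _ _ f (vertexMap_sub_add hf r.unop) := rfl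
    have := congrArg (fun q => Φ.map q.op) e
    rw [op_comp, op_comp, Φ.map_comp, Φ.map_comp] at this
    exact this

/-- By contravariance the composite is `Φ` of the map induced by `g ∘ f`. The structural morphism is
definitionally `Φ` of the map induced by `id`. -/
theorem interleavingMap_comp {Φ : SSet.{u}ᵒᵖ ⥤ C} (hΦ : IdentifiesContiguous Φ)
    (hF : Monotone F) (hG : Monotone G) {f : X → Y} {g : Y → X}
    (hf : ∀ a b, a + ε ≤ b → ∀ σ ∈ F a, f '' σ ∈ G b)
    (hg : ∀ a b, a + ε ≤ b → ∀ σ ∈ G a, g '' σ ∈ F b)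
    (hgf : ∀ a b, a + ε + ε ≤ b → Contiguous (F a) (F b) (g ∘ f) id) (r : ℝ)
    (hr : r - ε - ε ≤ r) :
    (interleavingMap Φ hG hF ε g hg).app (op r) ≫
        (interleavingMap Φ hF hG ε f hf).app (op (r - ε)) =
      structural ((vertexFiltration F hF).op ⋙ Φ) hr := by
  have h := hΦ (F (r - ε - ε)) (F r) (g ∘ f) id (hgf _ _ (by linarith))
  have e := Φ.map_comp (vertexMap _ _ g (vertexMap_sub_add hg r)).op
    (vertexMap _ _ f (vertexMap_sub_add hf (r - ε))).op
  exact e.symm.trans h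

theorem interleaved_of_transfers {Φ : SSet.{u}ᵒᵖ ⥤ C} (hΦ : IdentifiesContiguous Φ)
    (hF : Monotone F) (hG : Monotone G) {ε : ℝ≥0} (h : Transfers R ε F G)
    (h' : Transfers (Function.swap R) ε G F) (hl : ∀ x, ∃ y, R x y) (hr : ∀ y, ∃ x, R x y) :
    Interleaved ε ((vertexFiltration F hF).op ⋙ Φ) ((vertexFiltration G hG).op ⋙ Φ) := by
  -- Any choice of partners works; no relation between `f` and `g` is required.
  choose f hf using hl
  choose g hg using hr
  have hf' : ∀ a b, a + (ε : ℝ) ≤ b → ∀ σ ∈ F a, f '' σ ∈ G b := fun _ _ => h.image_mem hf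
  have hg' : ∀ a b, a + (ε : ℝ) ≤ b → ∀ σ ∈ G a, g '' σ ∈ F b := fun _ _ => h'.image_mem hg
  exact ⟨interleavingMap Φ hG hF ε g hg', interleavingMap Φ hF hG ε f hf', fun r =>
    ⟨interleavingMap_comp hΦ hF hG hf' hg' (fun _ _ => h.contiguous h' hf hg) r _,
      interleavingMap_comp hΦ hG hF hg' hf' (fun _ _ => h'.contiguous h hg hf) r _⟩⟩

/-! ### Metric estimates from the distortion. -/

variable [MetricSpace X] [MetricSpace Y]

theorem transfers_rips (hR : ∀ x x' y y', R x y → R x' y' → |dist x x' - dist y y'| ≤ ε) :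
    Transfers R ε (ripsSimplices X) (ripsSimplices Y) := by
  intro a b hab σ hσ τ hτ y hy y' hy'
  obtain ⟨x, hx, hxy⟩ := hτ y hy
  obtain ⟨x', hx', hxy'⟩ := hτ y' hy'
  have := (abs_le.1 (hR x x' y y' hxy hxy')).1
  linarith [hσ x hx x' hx']

/-- A partner `q` of the common point `p` is a common point for the enlarged balls. The Čech complex
being intrinsic, `p` lies in `X` and so has a partner. -/
theorem transfers_cech (hR : ∀ x x' y y', R x y → R x' y' → |dist x x' - dist y y'| ≤ ε)
    (hl : ∀ x, ∃ y, R x y) : Transfers R ε (cechSimplices X) (cechSimplices Y) := by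
  rintro a b hab σ ⟨p, hp⟩ τ hτ
  obtain ⟨q, hq⟩ := hl p
  refine ⟨q, Set.mem_iInter₂.2 fun y hy => ?_⟩
  obtain ⟨x, hx, hxy⟩ := hτ y hy
  have h₁ : dist p x ≤ a := Set.mem_iInter₂.1 hp x hx
  have := (abs_le.1 (hR p x q y hq hxy)).1
  rw [Metric.mem_closedBall]
  linarith

theorem abs_dist_sub_dist_le_distortion {D : Set (X × Y)} (hD : distortion D ≠ ⊤) (x x' : X)
    (y y' : Y) (h : (x, y) ∈ D) (h' : (x', y') ∈ D) :
    |dist x x' - dist y y'| ≤ (distortion D).toNNReal := by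
  have : ENNReal.ofReal |dist x x' - dist y y'| ≤ distortion D :=
    (le_iSup₂ (f := fun (q : X × Y) (_ : q ∈ D) => ENNReal.ofReal |dist x q.1 - dist y q.2|)
      (x', y') h').trans
    (le_iSup₂ (f := fun (p : X × Y) (_ : p ∈ D) =>
      ⨆ (q ∈ D), ENNReal.ofReal |dist p.1 q.1 - dist p.2 q.2|) (x, y) h)
  exact (ENNReal.ofReal_le_iff_le_toReal hD).1 this

/-- The factor `2` cancels the `1/2` of the definition. Each correspondence is used with exactly its
own distortion, so the infimum need not be attained; infinite distortion gives a trivial bound. -/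
theorem interleavingDist_le_two_mul_gromovHausdorffDist {A B : ℝᵒᵖ ⥤ C}
    (h : ∀ D : Set (X × Y), IsCorrespondence D → distortion D ≠ ⊤ →
      Interleaved (distortion D).toNNReal A B) :
    interleavingDist A B ≤ 2 * gromovHausdorffDist X Y := by
  rw [gromovHausdorffDist, ← mul_assoc, one_div, ENNReal.mul_inv_cancel (by simp) (by simp),
    one_mul]
  refine le_iInf₂ fun D hD => ?_
  by_cases hfin : distortion D = ⊤
  · rw [hfin]
    exact le_top
  · exact iInf₂_le_of_le _ (h D hD hfin) (ENNReal.coe_toNNReal hfin).le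

theorem interleavingDist_rips_le {Φ : SSet.{u}ᵒᵖ ⥤ C} (hΦ : IdentifiesContiguous Φ)
    (X Y : Type u) [MetricSpace X] [MetricSpace Y] :
    interleavingDist ((rips X).op ⋙ Φ) ((rips Y).op ⋙ Φ) ≤ 2 * gromovHausdorffDist X Y :=
  interleavingDist_le_two_mul_gromovHausdorffDist fun D hD hfin =>
    have hR := abs_dist_sub_dist_le_distortion hfin
    interleaved_of_transfers hΦ _ _ (R := fun x y => (x, y) ∈ D) (transfers_rips hR)
      (transfers_rips fun y y' x x' h h' => abs_sub_comm (dist x x') _ ▸ hR x x' y y' h h') hD.1 hD.2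

theorem interleavingDist_cech_le {Φ : SSet.{u}ᵒᵖ ⥤ C} (hΦ : IdentifiesContiguous Φ)
    (X Y : Type u) [MetricSpace X] [MetricSpace Y] :
    interleavingDist ((cech X).op ⋙ Φ) ((cech Y).op ⋙ Φ) ≤ 2 * gromovHausdorffDist X Y :=
  interleavingDist_le_two_mul_gromovHausdorffDist fun D hD hfin =>
    have hR := abs_dist_sub_dist_le_distortion hfin
    interleaved_of_transfers hΦ _ _ (R := fun x y => (x, y) ∈ D) (transfers_cech hR hD.1)
      (transfers_cech (fun y y' x x' h h' => abs_sub_comm (dist x x') _ ▸ hR x x' y y' h h') hD.2)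
      hD.1 hD.2

end Stability

/-- Homotopy invariance under simplicial homotopies implies the identification of contiguous maps,
before and after geometric realization. -/
theorem identifiesContiguous_of_homotopy {C : Type*} [Category C] {Φ : SSet.{u}ᵒᵖ ⥤ C}
    (hΦ : ∀ ⦃S T : SSet.{u}⦄ ⦃f g : S ⟶ T⦄, SSet.Homotopy f g → Φ.map f.op = Φ.map g.op) :
    IdentifiesContiguous Φ ∧ IdentifiesContiguous ((SSet.toTop ⋙ TopCat.toSSet).op ⋙ Φ) :=
  ⟨fun _ _ _ _ _ _ h => hΦ h.homotopy, fun _ _ _ _ _ _ h => hΦ h.topHomotopy.toSSet⟩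

theorem mainTheorem3 (k : Type w) [Field k] (X Y : Type u) [MetricSpace X] [MetricSpace Y] :
    (distHoAs k (rips X) (rips Y) ≤ 2 * gromovHausdorffDist X Y ∧
      distHoAs k (cech X) (cech Y) ≤ 2 * gromovHausdorffDist X Y) ∧
    (distAs k (rips X) (rips Y) ≤ 2 * gromovHausdorffDist X Y ∧
      distAs k (cech X) (cech Y) ≤ 2 * gromovHausdorffDist X Y) ∧
    (distHoAsTop k (rips X ⋙ SSet.toTop) (rips Y ⋙ SSet.toTop) ≤ 2 * gromovHausdorffDist X Y ∧
      distHoAsTop k (cech X ⋙ SSet.toTop) (cech Y ⋙ SSet.toTop) ≤ 2 * gromovHausdorffDist X Y) ∧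
    (distAsTop k (rips X ⋙ SSet.toTop) (rips Y ⋙ SSet.toTop) ≤ 2 * gromovHausdorffDist X Y ∧
      distAsTop k (cech X ⋙ SSet.toTop) (cech Y ⋙ SSet.toTop) ≤ 2 * gromovHausdorffDist X Y) := by
  obtain ⟨h₁, h₁'⟩ := identifiesContiguous_of_homotopy.{u}
    (Φ := SSetCochain.functor k ⋙ DGAlg.toHo k) fun _ _ _ _ H => toHo_map_eq H
  obtain ⟨h₂, h₂'⟩ := identifiesContiguous_of_homotopy.{u}
    (Φ := SSetCochain.functor k ⋙ DGAlg.cohomologyFunctor k)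
    fun _ _ _ _ H => cohomologyFunctor_map_eq H
  -- The topological distances are, up to definitional reassociation of functors, those for `Φ`
  -- precomposed with `S ↦ Sing |S|`.
  exact ⟨⟨interleavingDist_rips_le h₁ X Y, interleavingDist_cech_le h₁ X Y⟩,
    ⟨interleavingDist_rips_le h₂ X Y, interleavingDist_cech_le h₂ X Y⟩,
    ⟨interleavingDist_rips_le h₁' X Y, interleavingDist_cech_le h₁' X Y⟩,
    ⟨interleavingDist_rips_le h₂' X Y, interleavingDist_cech_le h₂' X Y⟩⟩
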